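/- Let $R$ be a commutative ring with $1$ and $\mathbb S\subseteq R$ a countable multiplicatively closed subset containing $1$. For an $R$-module $M$ say that $M$ is *torsion-free* if $sm=0$ with $s\in\mathbb S$, $m\in M$ implies $m=0$; *reduced* if $\bigcap_{s\in\mathbb S}sM=0$; *cotorsion-free* if $\operatorname{Hom}_R(\widehat R,M)=0$, where $\widehat R=\varprojlim_{s\in\mathbb S}R/sR$ is the $\mathbb S$-adic completion of $R$; and *of finite rank $n$* if $M$ has a free submodule $E=\bigoplus_{i<n}Re_i$ such that every element of $M/E$ is annihilated by some $s\in\mathbb S$. An exact sequence $0\to K\to G\xrightarrow{\pi}H\to 0$ of $R$-modules is called *cellular* if $\pi$ is a cellular cover, that is, if $\varphi\mapsto\pi\varphi$ is a bijection $\operatorname{Hom}_R(G,G)\to\operatorname{Hom}_R(G,H)$. Assume that $R$ is torsion-free, reduced and cotorsion-free. Let $K$ be a cotorsion-free, reduced $R$-module of finite rank $\kappa$ with $|K|<2^{\aleph_0}$. Then there is a cellular exact sequence $0\to K\to G\xrightarrow{\pi} H\to 0$ of $R$-modules in which $G$ has rank $\kappa+2$ and $H$ is cotorsion-free of rank $2$.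 In particular, for every free abelian group $A$ of finite rank $\kappa$ there is a cellular exact sequence $0\to A\to G\to H\to 0$ of abelian groups in which $G$ has rank $\kappa+2$ and $H$ is cotorsion-free of rank $2$ (all notions taken for $R=\mathbb Z$, $\mathbb S=\mathbb Z\setminus\{0\}$). -/

import Mathlib

universe u v w

namespace SCell

section Basic

variable {R : Type u} [CommRing R] (S : Submonoid R)

/-- The `S`-adic completion of the ring `R`, as an `R`-module: the inverse limit of the quotients
`R / sR` for `s ∈ S`, i.e. the compatible families in their product. (The ideals `sR`, `s ∈ S`,
form a base of neighbourhoods of zero of the `S`-adic topology; for countable `S` so do the ideals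
generated by the finite products of the initial elements of an enumeration of `S`.) -/
def completion : Submodule R (∀ s : S, R ⧸ Ideal.span {(s : R)}) where
  carrier := {x | ∀ (s t : S) (h : Ideal.span {(t : R)} ≤ Ideal.span {(s : R)}),
    Ideal.Quotient.factorₐ R h (x t) = x s}
  zero_mem' := fun s t h => by simp only [Pi.zero_apply, map_zero]
  add_mem' := fun hx hy s t h => by simp only [Pi.add_apply, map_add, hx s t h, hy s t h]
  smul_mem' := fun r x hx s t h => by simp only [Pi.smul_apply, map_smul, hx s t h]

variable (M : Type v) [AddCommGroup M] [Module R M]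

/-- `M` is `S`-torsion-free. -/
def IsTorsionFree : Prop := ∀ s ∈ S, ∀ m : M, s • m = 0 → m = 0

/-- `M` is `S`-reduced: the intersection of all `sM`, `s ∈ S`, is zero, i.e. the `S`-adic topology
of `M` is Hausdorff. -/
def IsReduced : Prop := ∀ m : M, (∀ s ∈ S, ∃ n : M, s • n = m) → m = 0

/-- `M` is `S`-cotorsion-free: the only homomorphism from the completion of `R` to `M` is zero. -/
def IsCotorsionFree : Prop := ∀ f : completion S →ₗ[R] M, f = 0

/-- `M` has finite rank `n` (relative to `S`): it has a free submodule on `n` generators such that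
the quotient of `M` by it is `S`-torsion. -/
def HasRank (n : ℕ) : Prop :=
  ∃ e : Fin n → M, LinearIndependent R e ∧
    ∀ m : M, ∃ s ∈ S, s • m ∈ Submodule.span R (Set.range e)

end Basic

section Cellular

/-- `π : G → H` is a cellular cover: composition with `π` is a bijection
from `Hom(G, G)` to `Hom(G, H)`. -/
def IsCellularCover {R : Type*} {G : Type*} {H : Type*} [CommRing R]
    [AddCommGroup G] [Module R G] [AddCommGroup H] [Module R H] (π : G →ₗ[R] H) : Prop :=
  Function.Bijective (fun φ : G →ₗ[R] G => π ∘ₗ φ)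

/-- `0 → K → G → H → 0` is a cellular exact sequence. -/
structure IsCellularExact {R : Type*} {K : Type*} {G : Type*} {H : Type*} [CommRing R]
    [AddCommGroup K] [Module R K] [AddCommGroup G] [Module R G] [AddCommGroup H] [Module R H]
    (ι : K →ₗ[R] G) (π : G →ₗ[R] H) : Prop where
  injective : Function.Injective ι
  exact : Function.Exact ι π
  surjective : Function.Surjective π
  cellular : IsCellularCover π

end Cellular

end SCell

namespace SCell

open Filter

/-! ### Sequences modulo null sequences -/

section SequenceModule

variable {R : Type u} [CommRing R] (S : Submonoid R) (M : Type v) [AddCommGroup M] [Module R M]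

/-! Work in sequences modulo null sequences, a reduced module over `ℕ → R` that contains the given
reduced module as constants. The key is a Cauchy sequence `p` in `R` that is transcendental over
`K`: a relation `∑ p ^ j • k_j = 0` with `k_j` in `K` forces every `k_j` to vanish
(`exists_transcendental`, where `|K| < 2^ℵ₀` enters). For `κ > 0`, `R` embeds in `K`, so `p` is
transcendental over `R` as well.

Let `G` be the pure submodule generated by `K`, `g₁ = (1, 0)` and `g₂ = (p, ∑ p^(2i+3) e_i)`, and
let `H` be its first projection, the pure closure of `1` and `p`. As `g₂` is a limit of combinations
of `g₁` and the `e_i` with remainders in `G`, every homomorphism `f` into such a completion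
satisfies `f g₂ = p f(g₁) + ∑ p^(2i+3) f(e_i)` (`map_genTwo`). If `f` takes values in `K`,
transcendence gives `f = 0`, so lifts along `π` are unique. If `f` takes values in `H`, clear
denominators and write each value as `a + pb`; comparing powers of `p` makes `f` a scalar multiple
of `π`, which lifts to that scalar on `G`.

Finally `H` is small, torsion-free and reduced, and transcendence, applied to `H` itself, makes
every such module cotorsion-free. For `κ = 0` one has `K = 0`, and the identity of `R²` serves. -/

/-- The sequences in `M` converging to zero in the `S`-adic topology. -/
def nullSeq : Submodule (ℕ → R) (ℕ → M) where
  carrier := {x | ∀ s ∈ S, ∀ᶠ n in atTop, ∃ y : M, x n = s • y}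
  zero_mem' := fun s _ => Eventually.of_forall fun n => ⟨0, by simp⟩
  add_mem' := fun {x y} hx hy s hs => by
    filter_upwards [hx s hs, hy s hs] with n ⟨a, ha⟩ ⟨b, hb⟩
    exact ⟨a + b, by simp [ha, hb]⟩
  smul_mem' := fun r x hx s hs => by
    filter_upwards [hx s hs] with n ⟨a, ha⟩
    exact ⟨r n • a, by simp [ha, smul_comm (r n) s a]⟩

/-- Sequences in `M` modulo null sequences; the `S`-adic completion of `M` embeds into it. -/
abbrev SeqQuot := (ℕ → M) ⧸ nullSeq S M

/-- The constant sequences. -/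
def constSeq : M →ₗ[R] SeqQuot S M where
  toFun m := Submodule.Quotient.mk (fun _ => m)
  map_add' := fun _ _ => rfl
  map_smul' := fun _ _ => rfl

theorem smul_constSeq_one (r : R) : r • constSeq S R 1 = constSeq S R r := by
  rw [← map_smul, smul_eq_mul, mul_one]

variable {S M}

theorem mk_eq_zero_iff (x : ℕ → M) :
    (Submodule.Quotient.mk x : SeqQuot S M) = 0 ↔
      ∀ s ∈ S, ∀ᶠ n in atTop, ∃ y : M, x n = s • y := by
  rw [Submodule.Quotient.mk_eq_zero]; rfl

theorem IsTorsionFree.eq_of_smul_eq (hM : IsTorsionFree S M) {s : R} (hs : s ∈ S) {x y : M}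
    (h : s • x = s • y) : x = y :=
  sub_eq_zero.1 (hM s hs _ (by rw [smul_sub, h, sub_self]))

theorem constSeq_injective (hM : IsReduced S M) : Function.Injective (constSeq S M) := by
  rw [injective_iff_map_eq_zero]
  intro m hm
  refine hM m fun s hs => ?_
  obtain ⟨n, y, hy⟩ := ((mk_eq_zero_iff _).1 hm s hs).exists
  exact ⟨y, hy.symm⟩

/-- Purity of the constants: one late term of a representing sequence already exhibits the divisor.
-/
theorem constSeq_mem_smul {s : R} (hs : s ∈ S) {m : M} {y : SeqQuot S M}
    (h : constSeq S M m = s • y) : ∃ n, m = s • n := by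
  obtain ⟨y, rfl⟩ := Submodule.Quotient.mk_surjective _ y
  have h' : (Submodule.Quotient.mk ((fun _ => m) - s • y) : SeqQuot S M) = 0 :=
    sub_eq_zero.2 h
  obtain ⟨n, z, hz⟩ := ((mk_eq_zero_iff _).1 h' s hs).exists
  refine ⟨z + y n, ?_⟩
  rw [smul_add, ← hz]; simp

theorem seqQuot_isTorsionFree (hM : IsTorsionFree S M) : IsTorsionFree S (SeqQuot S M) := by
  intro s hs x hx
  obtain ⟨x, rfl⟩ := Submodule.Quotient.mk_surjective _ x
  have hx' : (Submodule.Quotient.mk (s • x) : SeqQuot S M) = 0 := hx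
  rw [mk_eq_zero_iff] at hx' ⊢
  intro t ht
  filter_upwards [hx' (s * t) (S.mul_mem hs ht)] with n ⟨y, hy⟩
  exact ⟨y, hM.eq_of_smul_eq hs (by rw [← mul_smul]; exact hy)⟩

/-- Being divisible by `s` modulo null sequences means that almost all terms are divisible by `s`;
for all `s` together this is nullity. -/
theorem seqQuot_isReduced : IsReduced S (SeqQuot S M) := by
  intro x hx
  obtain ⟨x, rfl⟩ := Submodule.Quotient.mk_surjective _ x
  rw [mk_eq_zero_iff]
  intro s hs
  obtain ⟨y, hy⟩ := hx s hs
  obtain ⟨y, rfl⟩ := Submodule.Quotient.mk_surjective _ y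
  have h' : (Submodule.Quotient.mk (x - s • y) : SeqQuot S M) = 0 := sub_eq_zero.2 hy.symm
  filter_upwards [(mk_eq_zero_iff _).1 h' s hs] with n ⟨z, hz⟩
  refine ⟨z + y n, ?_⟩
  rw [smul_add, ← hz]; simp

theorem IsTorsionFree.of_injective {N : Type w} [AddCommGroup N] [Module R N]
    (hM : IsTorsionFree S M) (f : N →ₗ[R] M) (hf : Function.Injective f) : IsTorsionFree S N :=
  fun s hs m hm => hf (by rw [map_zero]; exact hM s hs _ (by rw [← map_smul, hm, map_zero]))

theorem IsReduced.of_injective {N : Type w} [AddCommGroup N] [Module R N]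
    (hM : IsReduced S M) (f : N →ₗ[R] M) (hf : Function.Injective f) : IsReduced S N :=
  fun m hm => hf (by
    rw [map_zero]
    refine hM _ fun s hs => ?_
    obtain ⟨n, rfl⟩ := hm s hs
    exact ⟨f n, (map_smul f s n).symm⟩)

theorem IsCotorsionFree.of_injective {N : Type w} [AddCommGroup N] [Module R N]
    (hM : IsCotorsionFree S M) (f : N →ₗ[R] M) (hf : Function.Injective f) :
    IsCotorsionFree S N := fun g => by
  ext x
  refine hf ?_
  rw [LinearMap.zero_apply, map_zero]
  exact LinearMap.congr_fun (hM (f ∘ₗ g)) x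

variable (S) in
/-- The Cauchy sequences of the `S`-adic topology of `R`. -/
def IsCauchySeq (p : ℕ → R) : Prop := ∀ s ∈ S, ∃ n, ∀ m ≥ n, ∃ y, p m - p n = s * y

theorem exists_seq_smul_sub_eq {p : ℕ → R} {s : R} {n : ℕ}
    (hn : ∀ m ≥ n, ∃ y, p m - p n = s * y) (x : SeqQuot S M) : ∃ z, p • x - p n • x = s • z := by
  choose! y hy using hn
  obtain ⟨x, rfl⟩ := Submodule.Quotient.mk_surjective _ x
  refine ⟨Submodule.Quotient.mk (y • x), sub_eq_zero.1 ?_⟩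
  change (Submodule.Quotient.mk (p • x - p n • x - s • (y • x)) : SeqQuot S M) = 0
  rw [mk_eq_zero_iff]
  intro t ht
  filter_upwards [eventually_ge_atTop n] with m hm
  refine ⟨0, ?_⟩
  simp only [Pi.sub_apply, Pi.smul_apply, Pi.smul_apply', smul_zero]
  rw [← sub_smul, hy m hm, mul_smul, sub_self]

theorem exists_seq_pow_smul_sub_eq {p : ℕ → R} {s : R} {n : ℕ}
    (hn : ∀ m ≥ n, ∃ y, p m - p n = s * y) (j : ℕ) (x : SeqQuot S M) :
    ∃ z, p ^ j • x - p n ^ j • x = s • z := by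
  induction j generalizing x with
  | zero => exact ⟨0, by simp⟩
  | succ j ih =>
    obtain ⟨z, hz⟩ := ih (p • x)
    obtain ⟨z', hz'⟩ := exists_seq_smul_sub_eq hn x
    refine ⟨z + p n ^ j • z', ?_⟩
    rw [smul_add, ← hz, smul_comm s, ← hz', smul_sub, pow_succ, pow_succ, mul_smul, mul_smul]
    abel

variable (S M) in
/-- Evaluation of polynomials with coefficients in `M` at a sequence in `R`. -/
noncomputable def evalSeq (p : ℕ → R) : (ℕ →₀ M) →+ SeqQuot S M :=
  Finsupp.liftAddHom fun j =>
    (DistribSMul.toAddMonoidHom (SeqQuot S M) (p ^ j)).comp (constSeq S M).toAddMonoidHom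

theorem evalSeq_single (p : ℕ → R) (j : ℕ) (m : M) :
    evalSeq S M p (Finsupp.single j m) = p ^ j • constSeq S M m := by
  simp [evalSeq]

end SequenceModule

/-- Cramer's rule without division: multiply the system by the adjugate. -/
theorem det_smul_eq_zero {A : Type*} [CommRing A] {X : Type*} [AddCommGroup X] [Module A X]
    {n : Type*} [Fintype n] [DecidableEq n] (V : Matrix n n A) (x : n → X)
    (h : ∀ i, ∑ j, V i j • x j = 0) (k : n) : V.det • x k = 0 := by
  have h1 : ∑ j, (V.adjugate * V) k j • x j = 0 := by
    simp_rw [Matrix.mul_apply, Finset.sum_smul, mul_smul]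
    rw [Finset.sum_comm]
    simp_rw [← Finset.smul_sum, h, smul_zero, Finset.sum_const_zero]
  rw [Matrix.adjugate_mul] at h1
  simpa [Matrix.smul_apply, Matrix.one_apply] using h1

/-! ### Transcendental Cauchy sequences -/

section Transcendence

variable {R : Type u} [CommRing R] {S : Submonoid R} {M : Type v} [AddCommGroup M] [Module R M]

theorem exists_seq_eventually_dvd (hS : (S : Set R).Countable) :
    ∃ t : ℕ → R, (∀ n, t n ∈ S) ∧ ∀ s ∈ S, ∃ n₀, ∀ n ≥ n₀, s ∣ t n := by
  obtain ⟨f, hf⟩ := hS.exists_eq_range ⟨1, S.one_mem⟩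
  -- Products of initial segments of an enumeration of `S`.
  refine ⟨fun n => ∏ i ∈ Finset.range (n + 1), f i, fun n => S.prod_mem fun i _ => ?_,
    fun s hs => ?_⟩
  · exact hf.ge (Set.mem_range_self i)
  · obtain ⟨k, rfl⟩ : s ∈ Set.range f := hf.le hs
    exact ⟨k, fun n hn => Finset.dvd_prod_of_mem _ (by simp; omega)⟩

/-- The sequence of partial sums of `∑ ε i • t 0 * ⋯ * t (i - 1)`. -/
def subseries (t : ℕ → R) (ε : ℕ → Bool) (n : ℕ) : R :=
  ∑ i ∈ Finset.range n, if ε i then ∏ k ∈ Finset.range i, t k else 0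

theorem subseries_isCauchySeq {t : ℕ → R} (ht : ∀ s ∈ S, ∃ n₀, ∀ n ≥ n₀, s ∣ t n)
    (ε : ℕ → Bool) : IsCauchySeq S (subseries t ε) := by
  intro s hs
  obtain ⟨n₀, hn₀⟩ := ht s hs
  refine ⟨n₀ + 1, fun m hm => ?_⟩
  rw [subseries, subseries, ← Finset.sum_Ico_eq_sub _ hm]
  refine Finset.dvd_sum fun i hi => ?_
  rw [Finset.mem_Ico] at hi
  split_ifs
  · exact (hn₀ n₀ le_rfl).trans (Finset.dvd_prod_of_mem _ (by simp; omega))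
  · exact dvd_zero _

variable (S) in
/-- The sequences that are eventually a fixed element of `S` times a sequence which is constantly
a square root of one modulo `s`. -/
def almostDenominators (s : R) : Submonoid (ℕ → R) where
  carrier := {a | ∃ q ∈ S, ∃ u, u * u = 1 ∧ ∀ᶠ n in atTop, ∃ x, a n = q * (u + s * x)}
  one_mem' := ⟨1, S.one_mem, 1, one_mul 1, Eventually.of_forall fun n => ⟨0, by simp⟩⟩
  mul_mem' := by
    rintro a b ⟨q, hq, u, hu, h⟩ ⟨q', hq', u', hu', h'⟩
    refine ⟨q * q', S.mul_mem hq hq', u * u', by linear_combination u' * u' * hu + hu', ?_⟩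
    filter_upwards [h, h'] with n ⟨x, hx⟩ ⟨y, hy⟩
    refine ⟨u * y + u' * x + s * x * y, ?_⟩
    rw [Pi.mul_apply, hx, hy]
    ring

/-- The factor `q` cancels by torsion-freeness, and what remains is a unit modulo `s`, its own
inverse there. -/
theorem exists_eq_smul_of_almostDenominators (hM : IsTorsionFree S M) {s : R} (hs : s ∈ S)
    {a : ℕ → R} (ha : a ∈ almostDenominators S s) {m : M} (h : a • constSeq S M m = 0) :
    ∃ y, m = s • y := by
  obtain ⟨q, hq, u, hu, hx⟩ := ha
  have h' : (Submodule.Quotient.mk (a • fun _ => m) : SeqQuot S M) = 0 := h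
  obtain ⟨n, ⟨x, hx⟩, y, hy⟩ :=
    (hx.and ((mk_eq_zero_iff _).1 h' (q * s) (S.mul_mem hq hs))).exists
  have h1 : (u + s * x) • m = s • y := hM.eq_of_smul_eq hq (by
    rw [← mul_smul, ← mul_smul, ← hx, ← hy]; rfl)
  refine ⟨u • (y - x • m), ?_⟩
  rw [smul_comm, smul_sub s, ← h1, ← mul_smul s, ← sub_smul, add_sub_cancel_right, ← mul_smul, hu,
    one_smul]

/-- If the first disagreement is at `d ≥ n₀`, the difference is `± t 0 ⋯ t (d - 1)` plus a tail
divisible by `t 0 ⋯ t d`, and `s ∣ t d`. -/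
theorem subseries_sub_mem {t : ℕ → R} (htS : ∀ n, t n ∈ S) {s : R} {n₀ : ℕ}
    (hs : ∀ n ≥ n₀, s ∣ t n) {ε δ : ℕ → Bool} (hne : ε ≠ δ) (heq : ∀ i < n₀, ε i = δ i) :
    subseries t ε - subseries t δ ∈ almostDenominators S s := by
  classical
  have hex : ∃ i, ε i ≠ δ i := Function.ne_iff.1 hne
  obtain ⟨d, hd, hmin⟩ : ∃ d, ε d ≠ δ d ∧ ∀ i < d, ε i = δ i :=
    ⟨Nat.find hex, Nat.find_spec hex, fun i hi => not_not.1 (Nat.find_min hex hi)⟩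
  have hd₀ : n₀ ≤ d := by
    by_contra! h
    exact hd (heq d h)
  refine ⟨∏ k ∈ Finset.range d, t k, S.prod_mem fun i _ => htS i, if ε d then 1 else -1,
    by split_ifs <;> simp, ?_⟩
  filter_upwards [eventually_ge_atTop (d + 1)] with n hn
  have htail : (∏ k ∈ Finset.range d, t k) * s ∣ ∑ i ∈ Finset.Ico (d + 1) n,
      ((if ε i then ∏ k ∈ Finset.range i, t k else 0) -
        if δ i then ∏ k ∈ Finset.range i, t k else 0) := by
    refine Finset.dvd_sum fun i hi => ?_
    rw [Finset.mem_Ico] at hi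
    have : (∏ k ∈ Finset.range d, t k) * s ∣ ∏ k ∈ Finset.range i, t k := by
      refine (mul_dvd_mul_left _ (hs d hd₀)).trans ?_
      rw [← Finset.prod_range_succ]
      exact Finset.prod_dvd_prod_of_subset _ _ _ (by simpa using hi.1)
    refine dvd_sub ?_ ?_ <;> split_ifs <;> simp [this]
  obtain ⟨x, hx⟩ := htail
  refine ⟨x, ?_⟩
  rw [Pi.sub_apply, subseries, subseries, ← Finset.sum_sub_distrib,
    ← Finset.sum_range_add_sum_Ico _ hn, hx, Finset.sum_range_succ, Finset.sum_eq_zero]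
  · cases h1 : ε d <;> cases h2 : δ d <;> simp_all <;> ring
  · intro i hi
    rw [hmin i (Finset.mem_range.1 hi), sub_self]

theorem evalSeq_eq_sum (p : ℕ → R) (f : ℕ →₀ M) {N : ℕ} (hN : ∀ j ∈ f.support, j < N) :
    evalSeq S M p f = ∑ j : Fin N, p ^ (j : ℕ) • constSeq S M (f j) := by
  rw [Fin.sum_univ_eq_sum_range (fun j => p ^ j • constSeq S M (f j)) N]
  exact Finsupp.sum_of_support_subset f (fun j hj => Finset.mem_range.2 (hN j hj))
    (fun j m => p ^ j • constSeq S M m) (by simp)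

theorem mk_finsupp_nat_lt_continuum (hM : Cardinal.mk M < Cardinal.continuum) :
    Cardinal.mk (ℕ →₀ M) < Cardinal.continuum := by
  cases subsingleton_or_nontrivial M
  · exact (Cardinal.le_one_iff_subsingleton.2 inferInstance).trans_lt
      (Cardinal.one_lt_aleph0.trans Cardinal.aleph0_lt_continuum)
  · rw [Cardinal.mk_finsupp_lift_of_infinite]
    simpa using ⟨Cardinal.aleph0_lt_continuum, hM⟩

/-- Over a small module there are `S`-adic Cauchy sequences which are transcendental in the
completion. -/
theorem exists_transcendental (hS : (S : Set R).Countable) (hM : IsTorsionFree S M)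
    (hred : IsReduced S M) (hcard : Cardinal.mk M < Cardinal.continuum) :
    ∃ p : ℕ → R, IsCauchySeq S p ∧ Function.Injective (evalSeq S M p) := by
  obtain ⟨t, htS, ht⟩ := exists_seq_eventually_dvd hS
  by_contra! hcon
  have hroot : ∀ ε : ℕ → Bool, ∃ f : ℕ →₀ M, evalSeq S M (subseries t ε) f = 0 ∧ f ≠ 0 := by
    intro ε
    have := hcon _ (subseries_isCauchySeq ht ε)
    rw [injective_iff_map_eq_zero] at this
    push Not at this
    exact this
  choose F hF hF0 using hroot
  -- There are continuum many digit sequences but fewer polynomials over `M`, so infinitely many of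
  -- the series are roots of one nonzero `f`.
  obtain ⟨f, hf⟩ := Cardinal.exists_infinite_fiber (fun ε : ULift.{v} (ℕ → Bool) => F ε.down)
    (by simpa using mk_finsupp_nat_lt_continuum hcard)
  obtain ⟨ε₀⟩ : Nonempty _ := hf.nonempty
  have hf0 : f ≠ 0 := by
    have := ε₀.2
    rw [Set.mem_preimage, Set.mem_singleton_iff] at this
    rw [← this]
    exact hF0 _
  obtain ⟨k, hk⟩ := Finsupp.ne_iff.1 hf0
  obtain ⟨s, hs, hsk⟩ : ∃ s ∈ S, ∀ y : M, s • y ≠ f k := by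
    by_contra! h
    exact hk (hred _ h)
  obtain ⟨n₀, hn₀⟩ := ht s hs
  -- Pigeonhole again: infinitely many of these roots share the first `n₀` digits, so their
  -- differences are almost denominators for `s`.
  obtain ⟨c, hc⟩ := Finite.exists_infinite_fiber
    (fun (ε : (fun ε : ULift.{v} (ℕ → Bool) => F ε.down) ⁻¹' {f}) (i : Fin n₀) => ε.1.down i)
  set N := f.support.sup id + 1 with hN
  have hlt : ∀ j ∈ f.support, j < N := fun j hj =>
    Nat.lt_succ_of_le (Finset.le_sup (f := id) hj)
  obtain ⟨g⟩ : Nonempty (Fin N ↪ _) := ⟨Fin.valEmbedding.trans (Infinite.natEmbedding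
    ((fun (ε : (fun ε : ULift.{v} (ℕ → Bool) => F ε.down) ⁻¹' {f}) (i : Fin n₀) =>
      ε.1.down i) ⁻¹' {c}))⟩
  set e : Fin N → ℕ → Bool := fun i => (g i).1.1.down with he
  have hinj : Function.Injective e := fun i j hij =>
    g.injective (Subtype.ext (Subtype.ext (ULift.ext _ _ hij)))
  have hpre : ∀ i (l : ℕ) (hl : l < n₀), e i l = c ⟨l, hl⟩ := fun i l hl =>
    congrFun (g i).2 ⟨l, hl⟩
  have hev : ∀ i, evalSeq S M (subseries t (e i)) f = 0 := fun i => by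
    have h : F (e i) = f := (g i).1.2
    rw [← h]
    exact hF _
  -- With more roots than the degree of `f`, the Vandermonde determinant kills each coefficient. It
  -- is a product of differences of roots, so `f k` lies in `sM`, against the choice of `s`.
  have hdet := det_smul_eq_zero (Matrix.vandermonde fun i => subseries t (e i))
    (fun j => constSeq S M (f j)) (fun i => by
      rw [← hev i, evalSeq_eq_sum _ f hlt]
      rfl) ⟨k, hlt k (Finsupp.mem_support_iff.2 hk)⟩
  obtain ⟨y, hy⟩ := exists_eq_smul_of_almostDenominators hM hs (by
    rw [Matrix.det_vandermonde]
    refine Submonoid.prod_mem _ fun i _ => Submonoid.prod_mem _ fun j hj => ?_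
    refine subseries_sub_mem htS hn₀ (fun h => (Finset.mem_Ioi.1 hj).ne' (hinj h)) fun l hl => ?_
    rw [hpre _ _ hl, hpre _ _ hl]) hdet
  exact hsk y hy.symm

end Transcendence

/-! ### Cotorsion-freeness of small modules -/

section Cotorsion

variable {R : Type u} [CommRing R] {S : Submonoid R}

/-- In each coordinate `p m • x` is eventually constant; the eventual values form the product of `x`
by the limit of `p`. -/
theorem IsCauchySeq.exists_completion_mul {p : ℕ → R} (hp : IsCauchySeq S p) (x : completion S) :
    ∃ z : completion S, ∀ s : S, ∀ᶠ m in atTop, z.1 s = p m • x.1 s := by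
  have hp' : ∀ s : S, ∃ n, ∀ m ≥ n, ∃ y, p m - p n = s * y := fun s => hp s s.2
  choose n hn using hp'
  have key : ∀ s t : S, Ideal.span {(t : R)} ≤ Ideal.span {(s : R)} → ∀ m ≥ n t,
      p (n t) • x.1 s = p m • x.1 s := by
    intro s t hst m hm
    obtain ⟨y, hy⟩ := hn t m hm
    obtain ⟨r, hr⟩ := Ideal.Quotient.mk_surjective (x.1 s)
    have hts : (t : R) ∈ Ideal.span {(s : R)} := hst (Ideal.mem_span_singleton_self _)
    rw [eq_comm, ← sub_eq_zero, ← sub_smul, hy, ← hr]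
    change Ideal.Quotient.mk _ ((t * y : R) * r) = 0
    rw [Ideal.Quotient.eq_zero_iff_mem]
    exact Ideal.mul_mem_right _ _ (Ideal.mul_mem_right _ _ hts)
  refine ⟨⟨fun s => p (n s) • x.1 s, fun s t hst => ?_⟩, fun s => ?_⟩
  · rw [map_smul, x.2 s t hst, key s t hst _ (le_max_left _ (n s))]
    exact (key s s le_rfl _ (le_max_right (n t) _)).symm
  · filter_upwards [eventually_ge_atTop (n s)] with m hm
    exact key s s le_rfl m hm

theorem IsCauchySeq.exists_completion_sub {p : ℕ → R} (hp : IsCauchySeq S p)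
    (hR : IsTorsionFree S R) (x : completion S) :
    ∃ z : completion S, ∀ s ∈ S, ∃ n, (∀ m ≥ n, ∃ y, p m - p n = s * y) ∧
      ∃ w : completion S, z - p n • x = s • w := by
  obtain ⟨z, hz⟩ := hp.exists_completion_mul x
  refine ⟨z, fun s hs => ?_⟩
  obtain ⟨n, hn⟩ := hp s hs
  refine ⟨n, hn, ?_⟩
  choose! y hy using hn
  -- The quotients `(p m - p n) / s` are again Cauchy, by the condition on `p` for `s * t`; their
  -- limit times `x` is `w`. The maximum is needed because `y` is controlled only from `n` on.
  have hyC : IsCauchySeq S y := by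
    intro t ht
    obtain ⟨k, hk⟩ := hp (s * t) (S.mul_mem hs ht)
    refine ⟨max n k, fun m hm => ?_⟩
    obtain ⟨a, ha⟩ := hk m (le_of_max_le_right hm)
    obtain ⟨b, hb⟩ := hk (max n k) (le_max_right _ _)
    refine ⟨a - b, hR.eq_of_smul_eq hs ?_⟩
    simp only [smul_eq_mul]
    linear_combination hy (max n k) (le_max_left _ _) - hy m (le_of_max_le_left hm) + ha - hb
  obtain ⟨w, hw⟩ := hyC.exists_completion_mul x
  refine ⟨w, Subtype.ext (funext fun t => ?_)⟩
  obtain ⟨m, ⟨h1, h2⟩, h3⟩ := (((hz t).and (hw t)).and (eventually_ge_atTop n)).exists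
  change z.1 t - p n • x.1 t = s • w.1 t
  rw [h1, h2, ← sub_smul, hy m h3, mul_smul]

/-- Small torsion-free reduced modules are cotorsion-free. -/
theorem isCotorsionFree_of_mk_lt_continuum (hS : (S : Set R).Countable) (hR : IsTorsionFree S R)
    {M : Type v} [AddCommGroup M] [Module R M] (hM : IsTorsionFree S M)
    (hred : IsReduced S M) (hcard : Cardinal.mk M < Cardinal.continuum) :
    IsCotorsionFree S M := by
  obtain ⟨p, hp, hinj⟩ := exists_transcendental hS hM hred hcard
  intro f
  ext x
  obtain ⟨z, hz⟩ := hp.exists_completion_sub hR x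
  -- Since `z` is `x` times the limit of `p`, `f z = p • f x` holds in the completion; so `p` is a
  -- root of the polynomial `f(x) X - f(z)`.
  have h : evalSeq S M p (Finsupp.single 1 (f x) - Finsupp.single 0 (f z)) = 0 := by
    rw [map_sub, evalSeq_single, evalSeq_single, pow_one, pow_zero, one_smul]
    refine (mk_eq_zero_iff (p • (fun _ => f x) - fun _ => f z)).2 fun s hs => ?_
    obtain ⟨n, hn, w, hw⟩ := hz s hs
    filter_upwards [eventually_ge_atTop n] with m hm
    obtain ⟨y, hy⟩ := hn m hm
    refine ⟨y • f x - f w, ?_⟩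
    rw [smul_sub, ← map_smul f s w, ← hw, ← mul_smul, ← hy, map_sub, map_smul, sub_smul]
    simp
  have h0 := DFunLike.congr_fun (hinj (h.trans (map_zero _).symm)) 1
  simpa using h0

/-- If `s • m = 0`, the completion maps through `R / sR` to `M` with `1 ↦ m`. -/
theorem IsCotorsionFree.isTorsionFree {M : Type v} [AddCommGroup M] [Module R M]
    (hM : IsCotorsionFree S M) : IsTorsionFree S M := by
  intro s hs m hm
  let g : R ⧸ Ideal.span {s} →ₗ[R] M := Submodule.liftQ _ (LinearMap.toSpanSingleton R M m) (by
    rw [Ideal.span, Submodule.span_le, Set.singleton_subset_iff]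
    simpa using hm)
  have h := LinearMap.congr_fun
    (hM (g ∘ₗ LinearMap.proj (⟨s, hs⟩ : S) ∘ₗ (completion S).subtype))
    ⟨fun _ => 1, fun s t h => map_one _⟩
  have h1 : g 1 = m := (Submodule.liftQ_apply _ _ (1 : R)).trans (by simp)
  rw [← h1]
  exact h

end Cotorsion

/-! ### Rank and transport along isomorphisms -/

section Rank

variable {R : Type u} [CommRing R] {S : Submonoid R} {M : Type v} [AddCommGroup M] [Module R M]
  {N : Type w} [AddCommGroup N] [Module R N]

theorem HasRank.of_linearEquiv (e : M ≃ₗ[R] N) {n : ℕ} (h : HasRank S M n) : HasRank S N n := by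
  obtain ⟨b, hb, hspan⟩ := h
  refine ⟨e ∘ b, hb.map' e.toLinearMap e.ker, fun m => ?_⟩
  obtain ⟨s, hs, hm⟩ := hspan (e.symm m)
  refine ⟨s, hs, ?_⟩
  rw [Set.range_comp]
  have := Submodule.mem_map_of_mem (f := e.toLinearMap) hm
  rw [Submodule.map_span] at this
  simpa using this

theorem hasRank_of_basis {n : ℕ} (b : Module.Basis (Fin n) R M) : HasRank S M n :=
  ⟨b, b.linearIndependent, fun m => ⟨1, S.one_mem, by rw [b.span_eq]; trivial⟩⟩

theorem HasRank.of_exact {K : Type*} [AddCommGroup K] [Module R K] {f : K →ₗ[R] M} {g : M →ₗ[R] N}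
    (hf : Function.Injective f) (hfg : Function.Exact f g) (hg : Function.Surjective g)
    {k n : ℕ} (hK : HasRank S K k) (hN : HasRank S N n) : HasRank S M (k + n) := by
  obtain ⟨b, hb, hbspan⟩ := hK
  obtain ⟨c, hc, hcspan⟩ := hN
  choose d hd using fun i => hg (c i)
  have hd' : g ∘ d = c := funext hd
  refine ⟨Sum.elim (f ∘ b) d ∘ finSumFinEquiv.symm, ?_, fun m => ?_⟩
  · rw [linearIndependent_equiv finSumFinEquiv.symm, Fintype.linearIndependent_iff]
    intro a ha
    rw [Fintype.sum_sum_type] at ha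
    simp only [Sum.elim_inl, Sum.elim_inr, Function.comp_apply] at ha
    have h1 : ∑ i, a (Sum.inr i) • c i = 0 := by
      have := congrArg g ha
      simpa [hfg.apply_apply_eq_zero, hd] using this
    have h2 := Fintype.linearIndependent_iff.1 hc _ h1
    simp only [h2, zero_smul, Finset.sum_const_zero, add_zero, ← map_smul, ← map_sum] at ha
    have h3 := Fintype.linearIndependent_iff.1 hb _ (hf (ha.trans (map_zero f).symm))
    rintro (i | i)
    exacts [h3 i, h2 i]
  · rw [finSumFinEquiv.symm.surjective.range_comp, Set.Sum.elim_range, Submodule.span_union]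
    obtain ⟨s, hs, hm⟩ := hcspan (g m)
    rw [← hd', Set.range_comp, ← Submodule.map_span] at hm
    obtain ⟨m', hm', hgm⟩ := hm
    obtain ⟨x, hx⟩ := (hfg (s • m - m')).1 (by rw [map_sub, map_smul, hgm, sub_self])
    obtain ⟨t, ht, htx⟩ := hbspan x
    refine ⟨t * s, S.mul_mem ht hs, ?_⟩
    have h : (t * s) • m = f (t • x) + t • m' := by
      rw [map_smul, hx, ← smul_add, sub_add_cancel, mul_smul]
    rw [h, Set.range_comp, ← Submodule.map_span]
    exact Submodule.add_mem_sup (Submodule.mem_map_of_mem htx) (Submodule.smul_mem _ _ hm')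

theorem IsCellularExact.comp_linearEquiv {K : Type*} [AddCommGroup K] [Module R K]
    {N' : Type*} [AddCommGroup N'] [Module R N'] {f : K →ₗ[R] M} {g : M →ₗ[R] N}
    (h : IsCellularExact f g) (e : N ≃ₗ[R] N') : IsCellularExact f (e.toLinearMap ∘ₗ g) where
  injective := h.injective
  exact := fun x => by simpa using h.exact x
  surjective := e.surjective.comp h.surjective
  cellular := by
    refine ⟨fun a b hab => h.cellular.1 (LinearMap.ext fun x => ?_), fun a => ?_⟩
    · exact e.injective (LinearMap.congr_fun hab x)
    · obtain ⟨φ, hφ⟩ := h.cellular.2 (e.symm.toLinearMap ∘ₗ a)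
      refine ⟨φ, LinearMap.ext fun x => ?_⟩
      have := LinearMap.congr_fun hφ x
      exact (congrArg e this).trans (e.apply_symm_apply _)

end Rank

/-! ### The module `G` and its projection -/

section Construction

variable {R : Type u} [CommRing R] {S : Submonoid R} {K : Type v} [AddCommGroup K] [Module R K]

/-- Multiplying the coefficients by `e` carries a relation over `R` to one over `K`. -/
theorem evalSeq_injective_of_smul_injective {p : ℕ → R} (hp : Function.Injective (evalSeq S K p))
    {e : K} (he : ∀ r : R, r • e = 0 → r = 0) : Function.Injective (evalSeq S R p) := by
  rw [injective_iff_map_eq_zero] at hp ⊢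
  let L : SeqQuot S R →ₗ[ℕ → R] SeqQuot S K := Submodule.mapQ _ _
    (LinearMap.toSpanSingleton (ℕ → R) (ℕ → K) fun _ => e) fun x hx s hs => by
      filter_upwards [hx s hs] with n ⟨y, hy⟩
      refine ⟨y • e, ?_⟩
      rw [← smul_assoc, ← hy]
      rfl
  let φ : R →+ K := (LinearMap.toSpanSingleton R K e).toAddMonoidHom
  have hL : L.toAddMonoidHom.comp (evalSeq S R p) =
      (evalSeq S K p).comp (Finsupp.mapRange.addMonoidHom φ) := by
    ext j
    simp only [AddMonoidHom.comp_apply, Finsupp.singleAddHom_apply, evalSeq_single,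
      Finsupp.mapRange.addMonoidHom_apply, Finsupp.mapRange_single]
    exact L.map_smul (p ^ j) (constSeq S R _)
  intro f hf
  have h := hp _ ((DFunLike.congr_fun hL f).symm.trans (by simp [hf]))
  ext j
  have hj := DFunLike.congr_fun h j
  rw [Finsupp.mapRange.addMonoidHom_apply, Finsupp.mapRange_apply] at hj
  exact he _ hj

variable (S) in
/-- The first free generator of `cellularModule`. -/
def genOne : SeqQuot S R × SeqQuot S K := (constSeq S R 1, 0)

variable (S) in
/-- The second free generator of `cellularModule`, which is in the closure of the other ones. -/
def genTwo (p : ℕ → R) {κ : ℕ} (e : Fin κ → K) : SeqQuot S R × SeqQuot S K :=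
  (p • constSeq S R 1, ∑ i : Fin κ, p ^ (2 * (i : ℕ) + 3) • constSeq S K (e i))

variable (S K) in
/-- The embedding of `K` into `cellularModule`. -/
def constInr : K →ₗ[R] SeqQuot S R × SeqQuot S K :=
  LinearMap.inr R (SeqQuot S R) (SeqQuot S K) ∘ₗ constSeq S K

variable (S) in
/-- The pure submodule generated by `K`, `genOne` and `genTwo`. -/
def cellularModule (p : ℕ → R) {κ : ℕ} (e : Fin κ → K) :
    Submodule R (SeqQuot S R × SeqQuot S K) where
  carrier := {x | ∃ s ∈ S, ∃ (a b : R) (k : K),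
    s • x = a • genOne S + b • genTwo S p e + constInr S K k}
  zero_mem' := ⟨1, S.one_mem, 0, 0, 0, by simp⟩
  add_mem' := by
    rintro x y ⟨s, hs, a, b, k, hx⟩ ⟨t, ht, a', b', k', hy⟩
    refine ⟨s * t, S.mul_mem hs ht, t * a + s * a', t * b + s * b', t • k + s • k', ?_⟩
    have h : (s * t) • (x + y) = t • (s • x) + s • (t • y) := by module
    rw [h, hx, hy, map_add, map_smul, map_smul]
    module
  smul_mem' := by
    rintro r x ⟨s, hs, a, b, k, hx⟩
    refine ⟨s, hs, r * a, r * b, r • k, ?_⟩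
    rw [smul_comm, hx, map_smul]
    module

variable {p : ℕ → R} {κ : ℕ} {e : Fin κ → K}

theorem genOne_mem : genOne S ∈ cellularModule S p e := ⟨1, S.one_mem, 1, 0, 0, by simp⟩

theorem genTwo_mem : genTwo S p e ∈ cellularModule S p e := ⟨1, S.one_mem, 0, 1, 0, by simp⟩

theorem constInr_mem (k : K) : constInr S K k ∈ cellularModule S p e :=
  ⟨1, S.one_mem, 0, 0, k, by simp⟩

theorem mem_cellularModule_of_smul {s : R} (hs : s ∈ S) {x : SeqQuot S R × SeqQuot S K}
    (hx : s • x ∈ cellularModule S p e) : x ∈ cellularModule S p e := by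
  obtain ⟨t, ht, a, b, k, h⟩ := hx
  exact ⟨t * s, S.mul_mem ht hs, a, b, k, by rw [mul_smul, h]⟩

/-- Homomorphisms into completions are compatible with the limit defining `genTwo`. -/
theorem map_genTwo (hp : IsCauchySeq S p) {M : Type w} [AddCommGroup M] [Module R M]
    (f : cellularModule S p e →ₗ[R] SeqQuot S M) :
    f ⟨genTwo S p e, genTwo_mem⟩ = p • f ⟨genOne S, genOne_mem⟩ +
      ∑ i : Fin κ, p ^ (2 * (i : ℕ) + 3) • f ⟨constInr S K (e i), constInr_mem _⟩ := by
  refine sub_eq_zero.1 (seqQuot_isReduced _ fun s hs => ?_)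
  obtain ⟨n, hn⟩ := hp s hs
  obtain ⟨z, hz⟩ := exists_seq_smul_sub_eq hn (constSeq S R 1)
  choose y hy using fun i : Fin κ =>
    exists_seq_pow_smul_sub_eq hn (2 * (i : ℕ) + 3) (constSeq S K (e i))
  have hg : genTwo S p e = p n • genOne S + ∑ i : Fin κ, p n ^ (2 * (i : ℕ) + 3) •
      constInr S K (e i) + s • (z, ∑ i, y i) := by
    refine Prod.ext ?_ ?_
    · simp [genTwo, genOne, constInr, Prod.fst_sum, ← hz]
    · simp [genTwo, genOne, constInr, Prod.snd_sum, Finset.smul_sum, ← hy]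
  -- This is what purity of `G` is for: the remainder, divided by `s`, stays in `G`, so `f` can be
  -- applied to it.
  have hmem : (z, ∑ i, y i) ∈ cellularModule S p e := by
    refine mem_cellularModule_of_smul hs ?_
    rw [← sub_eq_iff_eq_add'.2 hg]
    exact sub_mem genTwo_mem (add_mem (Submodule.smul_mem _ _ genOne_mem)
      (sum_mem fun i _ => Submodule.smul_mem _ _ (constInr_mem _)))
  have hg' : (⟨genTwo S p e, genTwo_mem⟩ : cellularModule S p e) = p n • ⟨genOne S, genOne_mem⟩ +
      ∑ i : Fin κ, p n ^ (2 * (i : ℕ) + 3) • ⟨constInr S K (e i), constInr_mem _⟩ +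
      s • ⟨_, hmem⟩ := Subtype.ext (by simpa using hg)
  obtain ⟨w, hw⟩ := exists_seq_smul_sub_eq hn (f ⟨genOne S, genOne_mem⟩)
  choose x hx using fun i : Fin κ =>
    exists_seq_pow_smul_sub_eq hn (2 * (i : ℕ) + 3) (f ⟨constInr S K (e i), constInr_mem _⟩)
  refine ⟨f ⟨_, hmem⟩ - w - ∑ i, x i, ?_⟩
  rw [hg', map_add, map_add, map_sum, smul_sub, smul_sub, ← hw, Finset.smul_sum]
  simp only [← hx, map_smul, Finset.sum_sub_distrib]
  abel

/-- Homomorphisms to torsion-free modules are determined by their values at the generators. -/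
theorem cellularModule_hom_eq_zero (he : ∀ k : K, ∃ s ∈ S, s • k ∈ Submodule.span R (Set.range e))
    {X : Type w} [AddCommGroup X] [Module R X] (hX : IsTorsionFree S X)
    (f : cellularModule S p e →ₗ[R] X) (h1 : f ⟨genOne S, genOne_mem⟩ = 0)
    (h2 : f ⟨genTwo S p e, genTwo_mem⟩ = 0)
    (h3 : ∀ i, f ⟨constInr S K (e i), constInr_mem _⟩ = 0) : f = 0 := by
  have h4 : ∀ k, f ⟨constInr S K k, constInr_mem _⟩ = 0 := by
    intro k
    obtain ⟨s, hs, hk⟩ := he k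
    let g : K →ₗ[R] X := f ∘ₗ (constInr S K).codRestrict (cellularModule S p e) constInr_mem
    have hg : Submodule.span R (Set.range e) ≤ LinearMap.ker g := by
      rw [Submodule.span_le]
      rintro _ ⟨i, rfl⟩
      exact h3 i
    refine hX s hs _ ?_
    have := hg hk
    rw [LinearMap.mem_ker, map_smul] at this
    exact this
  ext ⟨x, hx⟩
  obtain ⟨s, hs, a, b, k, h⟩ := id hx
  refine hX s hs _ ?_
  have h5 : s • (⟨x, hx⟩ : cellularModule S p e) = a • ⟨genOne S, genOne_mem⟩ +
      b • ⟨genTwo S p e, genTwo_mem⟩ + ⟨constInr S K k, constInr_mem _⟩ := Subtype.ext h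
  rw [← map_smul, h5, map_add, map_add, map_smul, map_smul, h1, h2, h4]
  simp

variable (S) in
/-- The projection of `cellularModule` to the completion of `R`. -/
def cellularProj (p : ℕ → R) (e : Fin κ → K) : cellularModule S p e →ₗ[R] SeqQuot S R :=
  LinearMap.fst R (SeqQuot S R) (SeqQuot S K) ∘ₗ (cellularModule S p e).subtype

theorem exists_smul_cellularProj (x : cellularModule S p e) :
    ∃ s ∈ S, ∃ a b : R, s • cellularProj S p e x = constSeq S R a + p • constSeq S R b := by
  obtain ⟨x, s, hs, a, b, k, h⟩ := x
  refine ⟨s, hs, a, b, ?_⟩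
  have := congrArg Prod.fst h
  simp only [genOne, genTwo, constInr] at this
  rw [← smul_constSeq_one S a, ← smul_constSeq_one S b, smul_comm p b]
  simpa [cellularProj] using this

theorem exists_common_smul_cellularProj {ι : Type*} [Finite ι] (x : ι → cellularModule S p e) :
    ∃ s ∈ S, ∃ a b : ι → R, ∀ i,
      s • cellularProj S p e (x i) = constSeq S R (a i) + p • constSeq S R (b i) := by
  classical
  cases nonempty_fintype ι
  choose s hs a b h using fun i => exists_smul_cellularProj (x i)
  refine ⟨∏ i, s i, S.prod_mem fun i _ => hs i,
    fun i => (∏ j ∈ Finset.univ.erase i, s j) * a i,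
    fun i => (∏ j ∈ Finset.univ.erase i, s j) * b i, fun i => ?_⟩
  simp only [← smul_eq_mul, map_smul]
  rw [← Finset.prod_erase_mul _ _ (Finset.mem_univ i), mul_smul, h, smul_add, smul_comm _ p]

/-- A vanishing first coordinate gives `a + p b = 0`, hence `a = b = 0`; then a multiple `s • y` of
the second coordinate lies in `K`, which is pure. -/
theorem cellularProj_eq_zero (hK : IsTorsionFree S K) (hpR : Function.Injective (evalSeq S R p))
    {x : cellularModule S p e} (hx : cellularProj S p e x = 0) :
    ∃ k, x = ⟨constInr S K k, constInr_mem k⟩ := by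
  obtain ⟨⟨x, y⟩, s, hs, a, b, k, h⟩ := x
  obtain rfl : x = 0 := hx
  have h1 := congrArg Prod.fst h
  have h2 := congrArg Prod.snd h
  simp only [genOne, genTwo, constInr] at h1 h2
  have h0 : evalSeq S R p (Finsupp.single 0 a + Finsupp.single 1 b) = 0 := by
    rw [map_add, evalSeq_single, evalSeq_single, pow_zero, one_smul, pow_one]
    rw [← smul_constSeq_one S a, ← smul_constSeq_one S b, smul_comm p b]
    simpa using h1.symm
  have h0' := hpR (h0.trans (map_zero _).symm)
  have ha := DFunLike.congr_fun h0' 0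
  have hb := DFunLike.congr_fun h0' 1
  simp at ha hb
  subst ha hb
  have h3 : constSeq S K k = s • y := by simpa using h2.symm
  obtain ⟨k', rfl⟩ := constSeq_mem_smul hs h3
  refine ⟨k', Subtype.ext (Prod.ext rfl ?_)⟩
  exact (seqQuot_isTorsionFree hK).eq_of_smul_eq hs (by rw [← h3, map_smul]; rfl)

end Construction

/-! ### Cellularity, and rank and size of `H` -/

section Cellular

variable {R : Type u} [CommRing R] {S : Submonoid R} {K : Type v} [AddCommGroup K] [Module R K]
  {p : ℕ → R} {κ : ℕ} {e : Fin κ → K}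

/-- The only homomorphism from `cellularModule` into `K` is zero. -/
theorem cellularModule_hom_base_eq_zero (hp : IsCauchySeq S p)
    (hpK : Function.Injective (evalSeq S K p)) (hK : IsTorsionFree S K)
    (he : ∀ k : K, ∃ s ∈ S, s • k ∈ Submodule.span R (Set.range e))
    (f : cellularModule S p e →ₗ[R] SeqQuot S K) (hf : ∀ x, ∃ k, f x = constSeq S K k) :
    f = 0 := by
  choose k hk using hf
  have h := map_genTwo hp f
  simp only [hk] at h
  -- The exponents `0`, `1` and `2i + 3` are distinct, so each value is a separate coefficient.
  have h0 : evalSeq S K p (Finsupp.single 1 (k ⟨genOne S, genOne_mem⟩) +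
      ∑ i : Fin κ, Finsupp.single (2 * (i : ℕ) + 3) (k ⟨constInr S K (e i), constInr_mem _⟩) -
      Finsupp.single 0 (k ⟨genTwo S p e, genTwo_mem⟩)) = 0 := by
    simp only [map_sub, map_add, map_sum, evalSeq_single, pow_zero, one_smul, pow_one]
    rw [h, sub_self]
  have h0' := DFunLike.congr_fun (hpK (h0.trans (map_zero _).symm))
  have h1 := h0' 0
  have h2 := h0' 1
  have h3 := fun i : Fin κ => h0' (2 * (i : ℕ) + 3)
  simp at h1 h2
  simp [Finsupp.single_apply, Fin.val_inj] at h3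
  refine cellularModule_hom_eq_zero he (seqQuot_isTorsionFree hK) f ?_ ?_ fun i => ?_
  · rw [hk, h2, map_zero]
  · rw [hk, h1, map_zero]
  · rw [hk, h3, map_zero]

/-- Homomorphisms from `cellularModule` into its projection are scalar multiples of the
projection. -/
theorem cellularModule_hom_proj_eq_smul (hp : IsCauchySeq S p)
    (hpR : Function.Injective (evalSeq S R p)) (hR : IsTorsionFree S R)
    (he : ∀ k : K, ∃ s ∈ S, s • k ∈ Submodule.span R (Set.range e))
    (f : cellularModule S p e →ₗ[R] SeqQuot S R) (hf : ∀ x, ∃ y, f x = cellularProj S p e y) :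
    ∃ r : R, f = r • cellularProj S p e := by
  choose g hg using hf
  have hQ := seqQuot_isTorsionFree hR
  obtain ⟨s, hs, a, b, hab⟩ := exists_common_smul_cellularProj (S := S) (p := p) (e := e)
    (fun i : Option (Option (Fin κ)) => match i with
      | none => g ⟨genOne S, genOne_mem⟩
      | some none => g ⟨genTwo S p e, genTwo_mem⟩
      | some (some i) => g ⟨constInr S K (e i), constInr_mem _⟩)
  have hab1 := hab none
  have hab2 := hab (some none)
  have hab3 := fun i => hab (some (some i))
  simp only [← hg] at hab1 hab2 hab3
  have h := congrArg (s • ·) (map_genTwo hp f)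
  simp only [smul_add, Finset.smul_sum, smul_comm s, hab1, hab2, hab3] at h
  -- Values `a + p b` occupy exponents `0, 1` for `g₂`, `1, 2` for `g₁` and `2i + 3, 2i + 4` for
  -- `e_i`. The only collision is at `1`, forcing `b` of `g₂` to equal `a` of `g₁`; all other
  -- coefficients vanish.
  have h0 : evalSeq S R p (Finsupp.single 1 (a none) + Finsupp.single 2 (b none) +
      (∑ i : Fin κ, Finsupp.single (2 * (i : ℕ) + 3) (a (some (some i))) +
        ∑ i : Fin κ, Finsupp.single (2 * (i : ℕ) + 4) (b (some (some i)))) -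
      (Finsupp.single 0 (a (some none)) + Finsupp.single 1 (b (some none)))) = 0 := by
    simp only [map_sub, map_add, map_sum, evalSeq_single, pow_zero, one_smul, pow_one]
    rw [h, ← Finset.sum_add_distrib, pow_two, mul_smul]
    simp only [pow_succ p (2 * _ + 3), mul_smul, sub_self]
  have h0' := DFunLike.congr_fun (hpR (h0.trans (map_zero _).symm))
  have e0 := h0' 0
  have e1 := h0' 1
  have e2 := h0' 2
  have e3 := fun i : Fin κ => h0' (2 * (i : ℕ) + 3)
  have e4 := fun i : Fin κ => h0' (2 * (i : ℕ) + 4)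
  have hodd : ∀ i n : ℕ, 2 * i ≠ 2 * n + 1 := fun i n => by omega
  have heven : ∀ i n : ℕ, 2 * i + 1 ≠ 2 * n := fun i n => by omega
  simp at e0 e1 e2
  simp [Finsupp.single_apply, Fin.val_inj, heven] at e3
  simp [Finsupp.single_apply, Fin.val_inj, hodd] at e4
  rw [e2, map_zero, smul_zero, add_zero] at hab1
  -- The scalar is `a / s`, which lies in `R` because the constants are pure.
  obtain ⟨r, hr⟩ := constSeq_mem_smul hs hab1.symm
  refine ⟨r, sub_eq_zero.1 (cellularModule_hom_eq_zero he hQ _ ?_ ?_ fun i => ?_)⟩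
  · refine hQ s hs _ ?_
    rw [LinearMap.sub_apply, smul_sub, hab1, LinearMap.smul_apply, hr, map_smul, sub_eq_zero]
    congr 1
    change _ = r • constSeq S R 1
    rw [smul_constSeq_one]
  · refine hQ s hs _ ?_
    rw [LinearMap.sub_apply, smul_sub, hab2, e0, map_zero, zero_add, ← sub_eq_zero.1 e1,
      LinearMap.smul_apply, hr, map_smul, sub_eq_zero, smul_comm p]
    congr 1
    change _ = r • p • constSeq S R 1
    rw [smul_comm, smul_constSeq_one]
  · refine hQ s hs _ ?_
    rw [LinearMap.sub_apply, smul_sub, hab3, e3, e4, LinearMap.smul_apply]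
    change _ - s • r • (0 : SeqQuot S R) = 0
    simp

/-- The inclusion of `K` into `cellularModule`. -/
def cellularIncl (S : Submonoid R) (p : ℕ → R) (e : Fin κ → K) : K →ₗ[R] cellularModule S p e :=
  (constInr S K).codRestrict (cellularModule S p e) constInr_mem

/-- Two lifts of one map differ by a homomorphism into the kernel `K`, hence by zero; a multiple `r
• π` is lifted by `r • id`. -/
theorem isCellularExact_cellularModule (hp : IsCauchySeq S p)
    (hpK : Function.Injective (evalSeq S K p)) (hpR : Function.Injective (evalSeq S R p))
    (hR : IsTorsionFree S R) (hK : IsTorsionFree S K) (hred : IsReduced S K)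
    (he : ∀ k : K, ∃ s ∈ S, s • k ∈ Submodule.span R (Set.range e)) :
    IsCellularExact (cellularIncl S p e) (cellularProj S p e).rangeRestrict where
  injective := fun x y h => constSeq_injective hred (congrArg (fun z => z.1.2) h)
  exact := fun x => by
    refine ⟨fun h => ?_, ?_⟩
    · obtain ⟨k, rfl⟩ := cellularProj_eq_zero hK hpR (congrArg Subtype.val h)
      exact ⟨k, rfl⟩
    · rintro ⟨k, rfl⟩
      rfl
  surjective := LinearMap.surjective_rangeRestrict _
  cellular := by
    refine ⟨fun φ ψ h => ?_, fun f => ?_⟩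
    · have h1 : ∀ x, cellularProj S p e ((φ - ψ) x) = 0 := fun x => by
        have := congrArg Subtype.val (LinearMap.congr_fun h x)
        rw [LinearMap.sub_apply, map_sub, sub_eq_zero]
        exact this
      have h2 := cellularModule_hom_base_eq_zero hp hpK hK he
        (LinearMap.snd R (SeqQuot S R) (SeqQuot S K) ∘ₗ (cellularModule S p e).subtype ∘ₗ (φ - ψ))
        (fun x => by
          obtain ⟨k, hk⟩ := cellularProj_eq_zero hK hpR (h1 x)
          exact ⟨k, congrArg (fun z => z.1.2) hk⟩)
      refine sub_eq_zero.1 (LinearMap.ext fun x => Subtype.ext (Prod.ext (h1 x) ?_))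
      exact LinearMap.congr_fun h2 x
    · obtain ⟨r, hr⟩ := cellularModule_hom_proj_eq_smul hp hpR hR he
        ((LinearMap.range (cellularProj S p e)).subtype ∘ₗ f) (fun x => by
          obtain ⟨y, hy⟩ := (f x).2
          exact ⟨y, hy.symm⟩)
      refine ⟨r • LinearMap.id, LinearMap.ext fun x => Subtype.ext ?_⟩
      refine Eq.trans ?_ (LinearMap.congr_fun hr x).symm
      exact map_smul (cellularProj S p e) r x

theorem hasRank_range_cellularProj (hpR : Function.Injective (evalSeq S R p)) :
    HasRank S (LinearMap.range (cellularProj S p e)) 2 := by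
  refine ⟨![⟨constSeq S R 1, ⟨genOne S, genOne_mem⟩, rfl⟩,
    ⟨p • constSeq S R 1, ⟨genTwo S p e, genTwo_mem⟩, rfl⟩], ?_, ?_⟩
  · rw [LinearIndependent.pair_iff]
    intro a b hab
    have h0 : evalSeq S R p (Finsupp.single 0 a + Finsupp.single 1 b) = 0 := by
      have hab' : a • constSeq S R 1 + b • p • constSeq S R 1 = 0 := congrArg Subtype.val hab
      rw [map_add, evalSeq_single, evalSeq_single, pow_zero, one_smul, pow_one, ← hab',
        smul_comm b p, smul_constSeq_one, smul_constSeq_one]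
    have h0' := DFunLike.congr_fun (hpR (h0.trans (map_zero _).symm))
    exact ⟨by simpa using h0' 0, by simpa using h0' 1⟩
  · rintro ⟨_, x, rfl⟩
    obtain ⟨s, hs, a, b, h⟩ := exists_smul_cellularProj x
    refine ⟨s, hs, ?_⟩
    rw [Matrix.range_cons, Matrix.range_cons, Matrix.range_empty, Set.union_empty,
      Set.singleton_union, Submodule.mem_span_pair]
    refine ⟨a, b, Subtype.ext ?_⟩
    refine Eq.trans ?_ h.symm
    change a • constSeq S R 1 + b • p • constSeq S R 1 = _
    rw [smul_comm b p, smul_constSeq_one, smul_constSeq_one]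

/-- By torsion-freeness an element `(a + p b) / s` is determined by the triple `(s, a, b)`. -/
theorem mk_range_cellularProj_lt_continuum (hS : (S : Set R).Countable) (hR : IsTorsionFree S R)
    (hcard : Cardinal.mk R < Cardinal.continuum) :
    Cardinal.mk (LinearMap.range (cellularProj S p e)) < Cardinal.continuum := by
  have hx : ∀ x : LinearMap.range (cellularProj S p e), ∃ y : S × R × R,
      (y.1 : R) • x.1 = constSeq S R y.2.1 + p • constSeq S R y.2.2 := by
    rintro ⟨_, x, rfl⟩
    obtain ⟨s, hs, a, b, h⟩ := exists_smul_cellularProj x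
    exact ⟨⟨⟨s, hs⟩, a, b⟩, h⟩
  choose y hy using hx
  have hinj : Function.Injective y := fun x x' h => by
    have h1 := hy x
    rw [h, ← hy x'] at h1
    exact Subtype.ext ((seqQuot_isTorsionFree hR).eq_of_smul_eq (y x').1.2 h1)
  refine (Cardinal.mk_le_of_injective hinj).trans_lt ?_
  have hS' : Cardinal.mk S < Cardinal.continuum :=
    (Cardinal.le_aleph0_iff_set_countable.2 hS).trans_lt Cardinal.aleph0_lt_continuum
  simp only [Cardinal.mk_prod, Cardinal.lift_id]
  exact Cardinal.mul_lt_of_lt Cardinal.aleph0_le_continuum hS'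
    (Cardinal.mul_lt_of_lt Cardinal.aleph0_le_continuum hcard hcard)

end Cellular

/-! ### Positive rank and rank zero -/

theorem exists_cellularExact_of_pos {R : Type u} [CommRing R] {S : Submonoid R}
    (hS : (S : Set R).Countable) (hR : IsTorsionFree S R) {K : Type v} [AddCommGroup K] [Module R K]
    (hK : IsTorsionFree S K) (hred : IsReduced S K) (hcard : Cardinal.mk K < Cardinal.continuum)
    {κ : ℕ} (hκ : 0 < κ) (hrank : HasRank S K κ) :
    ∃ (G : Type (max u v)) (_ : AddCommGroup G) (_ : Module R G)
      (H : Type (max u v)) (_ : AddCommGroup H) (_ : Module R H)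
      (ι : K →ₗ[R] G) (π : G →ₗ[R] H),
      IsCellularExact ι π ∧ HasRank S G (κ + 2) ∧ HasRank S H 2 ∧ IsCotorsionFree S H := by
  obtain ⟨e, hli, he⟩ := id hrank
  obtain ⟨p, hp, hpK⟩ := exists_transcendental hS hK hred hcard
  have he0 : ∀ r : R, r • e ⟨0, hκ⟩ = 0 → r = 0 := fun r hr => by
    have := Fintype.linearIndependent_iff.1 hli (Pi.single ⟨0, hκ⟩ r)
      (by simpa [Pi.single_apply, ite_smul] using hr) ⟨0, hκ⟩
    simpa using this
  have hpR := evalSeq_injective_of_smul_injective hpK he0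
  have hcardR : Cardinal.mk R < Cardinal.continuum := by
    have hinj : Function.Injective (LinearMap.toSpanSingleton R K (e ⟨0, hκ⟩)) :=
      (injective_iff_map_eq_zero _).2 he0
    have := Cardinal.lift_mk_le_lift_mk_of_injective hinj
    exact Cardinal.lift_lt_continuum.1 (this.trans_lt (Cardinal.lift_lt_continuum.2 hcard))
  have hex := isCellularExact_cellularModule hp hpK hpR hR hK hred he
  have hH := hasRank_range_cellularProj (e := e) hpR
  -- Only a change of universe: the range does not involve that of `K`.
  let E : LinearMap.range (cellularProj S p e) ≃ₗ[R]
    ULift.{v} (LinearMap.range (cellularProj S p e)) := ULift.moduleEquiv.symm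
  refine ⟨cellularModule S p e, inferInstance, inferInstance,
    ULift.{v} (LinearMap.range (cellularProj S p e)), inferInstance, inferInstance,
    cellularIncl S p e, _, hex.comp_linearEquiv E,
    hrank.of_exact hex.injective hex.exact hex.surjective hH, hH.of_linearEquiv E, ?_⟩
  have hinj := Submodule.injective_subtype (LinearMap.range (cellularProj S p e))
  exact (isCotorsionFree_of_mk_lt_continuum hS hR
    ((seqQuot_isTorsionFree hR).of_injective _ hinj) (seqQuot_isReduced.of_injective _ hinj)
    (mk_range_cellularProj_lt_continuum hS hR hcardR)).of_injective _ E.symm.injective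

/-- Torsion-freeness forces `K = 0`. Nothing then bounds the size of `R`, so cotorsion-freeness of
`R²` comes from that of `R`. -/
theorem exists_cellularExact_of_hasRank_zero {R : Type u} [CommRing R] {S : Submonoid R}
    (hR : IsCotorsionFree S R) {K : Type v} [AddCommGroup K] [Module R K]
    (hK : IsTorsionFree S K) (hrank : HasRank S K 0) :
    ∃ (G : Type (max u v)) (_ : AddCommGroup G) (_ : Module R G)
      (H : Type (max u v)) (_ : AddCommGroup H) (_ : Module R H)
      (ι : K →ₗ[R] G) (π : G →ₗ[R] H),
      IsCellularExact ι π ∧ HasRank S G 2 ∧ HasRank S H 2 ∧ IsCotorsionFree S H := by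
  have hK0 : ∀ k : K, k = 0 := fun k => by
    obtain ⟨e, -, he⟩ := hrank
    obtain ⟨s, hs, h⟩ := he k
    rw [Set.range_eq_empty, Submodule.span_empty, Submodule.mem_bot] at h
    exact hK s hs k h
  have hrank2 : HasRank S (ULift.{max u v} (Fin 2 → R)) 2 :=
    (hasRank_of_basis (Pi.basisFun R (Fin 2))).of_linearEquiv ULift.moduleEquiv.symm
  refine ⟨ULift.{max u v} (Fin 2 → R), inferInstance, inferInstance,
    ULift.{max u v} (Fin 2 → R), inferInstance, inferInstance, 0, LinearMap.id, ⟨?_, ?_, ?_, ?_⟩,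
    hrank2, hrank2, ?_⟩
  · exact fun x y _ => (hK0 x).trans (hK0 y).symm
  · exact fun x => ⟨fun h => ⟨0, h.symm⟩, fun ⟨_, h⟩ => h.symm⟩
  · exact Function.surjective_id
  · exact Function.bijective_id
  · intro f
    ext x i
    exact LinearMap.congr_fun
      (hR (LinearMap.proj i ∘ₗ (ULift.moduleEquiv (R := R)).toLinearMap ∘ₗ f)) x

/-! ### Free abelian groups -/

theorem countable_of_finite_int (A : Type w) [AddCommGroup A] [Module.Finite ℤ A] :
    Countable A := by
  obtain ⟨n, f, hf⟩ := Module.Finite.exists_fin' ℤ A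
  exact hf.countable

theorem isTorsionFree_of_free_int (A : Type w) [AddCommGroup A] [Module.Free ℤ A] :
    IsTorsionFree (nonZeroDivisors ℤ) A := fun _ hs _ hm =>
  (smul_eq_zero.1 hm).resolve_left (nonZeroDivisors.ne_zero hs)

theorem isReduced_of_free_int (A : Type w) [AddCommGroup A] [Module.Free ℤ A] :
    IsReduced (nonZeroDivisors ℤ) A := by
  intro m hm
  let b := Module.Free.chooseBasis ℤ A
  refine b.ext_elem fun i => ?_
  -- A divisor exceeding the absolute value of the coordinate forces that coordinate to be zero.
  obtain ⟨n, hn⟩ := hm (2 * (|b.repr m i| + 1)) (mem_nonZeroDivisors_of_ne_zero (by positivity))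
  rw [map_zero, Finsupp.zero_apply]
  refine Int.eq_zero_of_abs_lt_dvd (m := 2 * (|b.repr m i| + 1)) ⟨b.repr n i, ?_⟩ (by
    have := abs_nonneg (b.repr m i); omega)
  conv_lhs => rw [← hn]
  simp

theorem isCotorsionFree_of_free_int (A : Type w) [AddCommGroup A] [Module.Free ℤ A]
    [Module.Finite ℤ A] : IsCotorsionFree (nonZeroDivisors ℤ) A := by
  have := countable_of_finite_int A
  exact isCotorsionFree_of_mk_lt_continuum (Set.to_countable _) (isTorsionFree_of_free_int ℤ)
    (isTorsionFree_of_free_int A) (isReduced_of_free_int A)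
    ((Cardinal.mk_le_aleph0).trans_lt Cardinal.aleph0_lt_continuum)

theorem exists_cellularExact {R : Type u} [CommRing R] {S : Submonoid R}
    (hS : (S : Set R).Countable) (hR : IsTorsionFree S R) (hR' : IsCotorsionFree S R)
    {K : Type v} [AddCommGroup K] [Module R K] (hK : IsTorsionFree S K) (hred : IsReduced S K)
    (hcard : Cardinal.mk K < Cardinal.continuum) {κ : ℕ} (hrank : HasRank S K κ) :
    ∃ (G : Type (max u v)) (_ : AddCommGroup G) (_ : Module R G)
      (H : Type (max u v)) (_ : AddCommGroup H) (_ : Module R H)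
      (ι : K →ₗ[R] G) (π : G →ₗ[R] H),
      IsCellularExact ι π ∧ HasRank S G (κ + 2) ∧ HasRank S H 2 ∧ IsCotorsionFree S H := by
  obtain rfl | hκ := Nat.eq_zero_or_pos κ
  · exact exists_cellularExact_of_hasRank_zero hR' hK hrank
  · exact exists_cellularExact_of_pos hS hR hK hred hcard hκ hrank

end SCell

theorem theorem4p2 :
    (∀ (R : Type u) [CommRing R] (S : Submonoid R),
      (S : Set R).Countable →
      SCell.IsTorsionFree S R → SCell.IsReduced S R → SCell.IsCotorsionFree S R →
      ∀ (K : Type v) [AddCommGroup K] [Module R K],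
        SCell.IsCotorsionFree S K → SCell.IsReduced S K →
        Cardinal.mk K < Cardinal.continuum →
        ∀ κ : ℕ, SCell.HasRank S K κ →
        ∃ (G : Type (max u v)) (_ : AddCommGroup G) (_ : Module R G)
          (H : Type (max u v)) (_ : AddCommGroup H) (_ : Module R H)
          (ι : K →ₗ[R] G) (π : G →ₗ[R] H),
          SCell.IsCellularExact ι π ∧
          SCell.HasRank S G (κ + 2) ∧ SCell.HasRank S H 2 ∧ SCell.IsCotorsionFree S H) ∧
    (∀ (A : Type w) [AddCommGroup A] [Module.Free ℤ A] [Module.Finite ℤ A],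
        ∃ (G : Type w) (_ : AddCommGroup G) (H : Type w) (_ : AddCommGroup H)
          (ι : A →ₗ[ℤ] G) (π : G →ₗ[ℤ] H),
          SCell.IsCellularExact ι π ∧
          SCell.HasRank (nonZeroDivisors ℤ) G (Module.finrank ℤ A + 2) ∧
          SCell.HasRank (nonZeroDivisors ℤ) H 2 ∧
          SCell.IsCotorsionFree (nonZeroDivisors ℤ) H) := by
  refine ⟨fun R _ S hS hR _ hR' K _ _ hK hred hcard κ hrank =>
    SCell.exists_cellularExact hS hR hR' hK.isTorsionFree hred hcard hrank, fun A _ _ _ => ?_⟩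
  have := SCell.countable_of_finite_int A
  obtain ⟨G, _, mG, H, _, mH, h⟩ := SCell.exists_cellularExact (S := nonZeroDivisors ℤ)
    (Set.to_countable _) (SCell.isTorsionFree_of_free_int ℤ) (SCell.isCotorsionFree_of_free_int ℤ)
    (SCell.isTorsionFree_of_free_int A) (SCell.isReduced_of_free_int A)
    (Cardinal.mk_le_aleph0.trans_lt Cardinal.aleph0_lt_continuum)
    (SCell.hasRank_of_basis (Module.finBasis ℤ A))
  -- The `ℤ`-module structure obtained is replaced by the canonical one; they agree by uniqueness.
  obtain rfl : mG = AddCommGroup.toIntModule G := Subsingleton.elim _ _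
  obtain rfl : mH = AddCommGroup.toIntModule H := Subsingleton.elim _ _
  exact ⟨G, _, H, _, h⟩
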